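/- Theorem. A complex affine variety means here a subset of some $\mathbb{C}^n$ which is the set of common zeros of a family of polynomials (not necessarily irreducible), with its Zariski topology; morphisms are maps given by polynomials in the coordinates. Let $G$ be an algebraic group over $\mathbb{C}$, that is, an affine variety with a group structure whose product $G\times G\to G$ and inverse $G\to G$ are morphisms. A finite-dimensional $G$-module is a finite-dimensional complex representation of $G$ whose matrix coefficients are regular functions on $G$. Suppose that $G$ satisfies the Nagata hypothesis: for every finite-dimensional $G$-module $M$ and every $G$-invariant hyperplane $N\subseteq M$ such that $G$ acts trivially on $M/N$, there is a decomposition $M=H\oplus P$ as $G$-modules in which $H$ is a hyperplane (codimension one) and $P$ is a trivial representation. Let $G$ act on an affine variety $Z$ through a morphism $G\times Z\to Z$. Let $\mathbb{C}[Z]^G$ be the ring of $G$-invariant regular functions on $Z$, and for $z\in Z$ let $\Delta(z)$ be the closure in $Z$ of the orbit of $z$. For $z_1,z_2\in Z$ define $z_1\approx z_2$ if and only if $\Delta(z_1)\cap\Delta(z_2)\neq\emptyset$. Then: (i) $\approx$ is an equivalence relation on $Z$. (ii) $z_1\approx z_2$ if and only if $f(z_1)=f(z_2)$ for all $f\in\mathbb{C}[Z]^G$.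 (iii) For every $z\in Z$, the set $\Delta(z)$ contains exactly one orbit that is closed in $Z$, and the dimension of this orbit is minimal among the dimensions of all orbits contained in $\Delta(z)$. (The dimension of an orbit is its Krull dimension in the induced Zariski topology.) -/

import Mathlib

noncomputable section

namespace AffineGIT

open MvPolynomial

/-- The set of common zeros in `ℂⁿ` of a set `S` of polynomials. -/
def zeroSet {n : ℕ} (S : Set (MvPolynomial (Fin n) ℂ)) : Set (Fin n → ℂ) :=
  {x | ∀ p ∈ S, eval x p = 0}

/-- Affine varieties, as closed subsets of `ℂⁿ` (irreducibility is not required). -/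
def IsAffineVariety {n : ℕ} (Z : Set (Fin n → ℂ)) : Prop :=
  ∃ S : Set (MvPolynomial (Fin n) ℂ), Z = zeroSet S

/-- The Zariski topology on `ℂⁿ`: the closed sets are the zero sets. -/
@[reducible] def zariskiSpace (n : ℕ) : TopologicalSpace (Fin n → ℂ) :=
  TopologicalSpace.ofClosed {Z | IsAffineVariety Z}
    ⟨{1}, by ext x; simp [zeroSet]⟩
    (by
      intro A hA
      refine ⟨{p | ∃ S : Set (MvPolynomial (Fin n) ℂ), zeroSet S ∈ A ∧ p ∈ S}, ?_⟩
      ext x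
      constructor
      · rintro hx p ⟨S, hS, hp⟩
        exact hx _ hS p hp
      · intro hx Y hY
        obtain ⟨S, rfl⟩ := hA hY
        exact fun p hp => hx p ⟨S, hY, hp⟩)
    (by
      rintro _ ⟨S, rfl⟩ _ ⟨T, rfl⟩
      refine ⟨{p | ∃ s ∈ S, ∃ t ∈ T, p = s * t}, ?_⟩
      ext x
      constructor
      · rintro (hx | hx) p ⟨s, hs, t, ht, rfl⟩
        · simp [hx s hs]
        · simp [hx t ht]
      · intro hx
        by_contra hcon
        simp only [Set.mem_union, not_or, zeroSet, Set.mem_ofPred_eq, not_forall] at hcon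
        obtain ⟨⟨s, hs, hsx⟩, t, ht, htx⟩ := hcon
        have h := hx (s * t) ⟨s, hs, t, ht, rfl⟩
        rw [map_mul] at h
        exact (mul_ne_zero hsx htx) h)

/-- The Zariski topology on a subset `Z` of `ℂⁿ`. -/
@[reducible] def zariski {n : ℕ} (Z : Set (Fin n → ℂ)) : TopologicalSpace Z :=
  (zariskiSpace n).induced Subtype.val

/-- The Zariski closure, in `Z`, of a subset of `Z`. -/
def zariskiClosure {n : ℕ} {Z : Set (Fin n → ℂ)} (W : Set Z) : Set Z :=
  @closure Z (zariski Z) W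

/-- A subset of `Z` is closed in the Zariski topology of `Z`. -/
def IsZariskiClosed {n : ℕ} {Z : Set (Fin n → ℂ)} (W : Set Z) : Prop :=
  @IsClosed Z (zariski Z) W

/-- The dimension of a subset of `Z`: the supremum of the lengths of chains of irreducible closed
subsets, for the topology induced by the Zariski topology. -/
def zariskiDim {n : ℕ} {Z : Set (Fin n → ℂ)} (W : Set Z) : WithBot ℕ∞ :=
  @topologicalKrullDim W ((zariski Z).induced Subtype.val)

/-- The coordinate ring `ℂ[Z]`: the functions on `Z` that are restrictions of polynomials. -/
def coordinateRing {n : ℕ} (Z : Set (Fin n → ℂ)) : Subalgebra ℂ (Z → ℂ) :=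
  (aeval (R := ℂ) (fun (i : Fin n) (z : Z) => z.1 i)).range

/-- Regular functions on a product `X × Y`: the restrictions of polynomials in both sets of
coordinates. -/
def IsRegularOnProd {m n : ℕ} {X : Set (Fin m → ℂ)} {Y : Set (Fin n → ℂ)}
    (f : X → Y → ℂ) : Prop :=
  ∃ p : MvPolynomial (Fin m ⊕ Fin n) ℂ, ∀ x y, f x y = eval (Sum.elim x.1 y.1) p

/-- `G` is an algebraic group: an affine variety with a group structure whose product
`G × G → G` and inverse `G → G` are morphisms. -/
structure IsAlgebraicGroup {m : ℕ} (G : Set (Fin m → ℂ)) [Group G] : Prop where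
  isAffineVariety : IsAffineVariety G
  regular_mul : ∀ i, IsRegularOnProd fun g h : G => (g * h).1 i
  regular_inv : ∀ i, (fun g : G => (g⁻¹).1 i) ∈ coordinateRing G

/-- A finite-dimensional `G`-module is algebraic: all of its matrix coefficients are regular
functions on `G`. -/
def IsAlgebraicRep {m : ℕ} (G : Set (Fin m → ℂ)) [Group G] {M : Type} [AddCommGroup M]
    [Module ℂ M] (ρ : Representation ℂ G M) : Prop :=
  ∀ (v : M) (ξ : Module.Dual ℂ M), (fun g : G => ξ (ρ g v)) ∈ coordinateRing G

/-- The Nagata hypothesis: whenever a finite-dimensional algebraic `G`-module `M` has an invariant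
hyperplane `N` with trivial quotient `M / N`, there is a decomposition `M = H ⊕ P` into submodules,
where `H` is a hyperplane and `P` is a trivial representation. -/
def NagataHypothesis {m : ℕ} (G : Set (Fin m → ℂ)) [Group G] : Prop :=
  ∀ (M : Type) [AddCommGroup M] [Module ℂ M] [FiniteDimensional ℂ M]
    (ρ : Representation ℂ G M), IsAlgebraicRep G ρ →
    ∀ N : Submodule ℂ M, Module.finrank ℂ (M ⧸ N) = 1 →
      (∀ g, ∀ x ∈ N, ρ g x ∈ N) → (∀ g x, ρ g x - x ∈ N) →
      ∃ H P : Submodule ℂ M, IsCompl H P ∧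
        Module.finrank ℂ (M ⧸ H) = 1 ∧ (∀ g, ∀ x ∈ H, ρ g x ∈ H) ∧
        ∀ g, ∀ x ∈ P, ρ g x = x

/-- The group action `G × Z → Z` is a morphism. -/
def IsAlgebraicAction {m n : ℕ} (G : Set (Fin m → ℂ)) [Group G] (Z : Set (Fin n → ℂ))
    [MulAction G Z] : Prop :=
  ∀ i, IsRegularOnProd fun (g : G) (z : Z) => (g • z).1 i

/-- The ring `ℂ[Z]^G` of invariant regular functions. -/
def invariantRing {m n : ℕ} (G : Set (Fin m → ℂ)) [Group G] (Z : Set (Fin n → ℂ))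
    [MulAction G Z] : Subalgebra ℂ (Z → ℂ) where
  carrier := {f | f ∈ coordinateRing Z ∧ ∀ (g : G) (z : Z), f (g • z) = f z}
  mul_mem' := fun ha hb => ⟨mul_mem ha.1 hb.1, fun g z => by simp [ha.2 g z, hb.2 g z]⟩
  add_mem' := fun ha hb => ⟨add_mem ha.1 hb.1, fun g z => by simp [ha.2 g z, hb.2 g z]⟩
  algebraMap_mem' := fun c => ⟨Subalgebra.algebraMap_mem _ c, fun _ _ => rfl⟩

/-- The orbit closure `Δ(z)`: the Zariski closure of the orbit of `z` in `Z`. -/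
def orbitClosure {m n : ℕ} (G : Set (Fin m → ℂ)) [Group G] {Z : Set (Fin n → ℂ)}
    [MulAction G Z] (z : Z) : Set Z :=
  zariskiClosure (MulAction.orbit G z)

/-- The relation `z₁ ≈ z₂`: the orbit closures of `z₁` and `z₂` meet. -/
def ClosuresMeet {m n : ℕ} (G : Set (Fin m → ℂ)) [Group G] {Z : Set (Fin n → ℂ)}
    [MulAction G Z] (z₁ z₂ : Z) : Prop :=
  (orbitClosure G z₁ ∩ orbitClosure G z₂).Nonempty

/-- `W` is a closed orbit contained in `Δ(z)`. -/
def IsClosedOrbitIn {m n : ℕ} (G : Set (Fin m → ℂ)) [Group G] {Z : Set (Fin n → ℂ)}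
    [MulAction G Z] (z : Z) (W : Set Z) : Prop :=
  (∃ w : Z, W = MulAction.orbit G w) ∧ IsZariskiClosed W ∧ W ⊆ orbitClosure G z

end AffineGIT

end

/-! If the closures of two orbits are disjoint, the Nullstellensatz yields a regular function equal
to `0` on the first and to `1` on the second. Its translates span a finite-dimensional algebraic
`G`-module consisting of functions which vanish on the first closure and are constant on the second,
so evaluation at a point of the second closure is a nonzero invariant functional. The Nagata
hypothesis, applied repeatedly to split off trivial summands on which this functional vanishes,
produces an invariant vector on which it does not, that is, an invariant function separating the two
closures. Hence `≈` says that all invariants agree, and `Δ(z)` contains at most one closed orbit.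

A closed orbit is found by Noetherian descent on orbit closures, once orbits are known to be locally
closed: an orbit is constructible by Chevalley's theorem, hence locally closed at one of its points,
and by homogeneity at all of them. For the dimension, the closed orbit lies in the closure of every
orbit contained in `Δ(z)`, and a locally closed set has the same dimension as its closure: in the
spectrum of `ℂ[Z]` every point of the closure specializes a point `x` of the set, and near `x` the
closure of `x` is the spectrum of a localization `A_f` of a finitely generated domain `A`, of the
same dimension as `A` because both dimensions are transcendence degrees. -/

section KrullDimension

open Topology TopologicalSpace Set

variable {X Y : Type*} [TopologicalSpace X] [TopologicalSpace Y] {f : Y → X}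

theorem isPreirreducible_preimage_of_forall_isLocallyClosed (hf : IsInducing f)
    (hmeets : ∀ S, IsLocallyClosed S → S.Nonempty → (f ⁻¹' S).Nonempty) {T : Set X}
    (hT : IsPreirreducible T) (hT' : IsClosed T) : IsPreirreducible (f ⁻¹' T) := by
  intro u v hu hv hTu hTv
  obtain ⟨U, hU, rfl⟩ := hf.isOpen_iff.1 hu
  obtain ⟨V, hV, rfl⟩ := hf.isOpen_iff.1 hv
  exact hmeets _ (hT'.isLocallyClosed.inter (hU.inter hV).isLocallyClosed)
    (hT U V hU hV (hTu.image f |>.mono (by grind)) (hTv.image f |>.mono (by grind)))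

theorem topologicalKrullDim_le_of_forall_isLocallyClosed (hf : IsInducing f)
    (hmeets : ∀ S, IsLocallyClosed S → S.Nonempty → (f ⁻¹' S).Nonempty) :
    topologicalKrullDim X ≤ topologicalKrullDim Y := by
  let preimage (T : IrreducibleCloseds X) : IrreducibleCloseds Y :=
    ⟨f ⁻¹' T, ⟨hmeets _ T.isClosed.isLocallyClosed T.isIrreducible.nonempty,
      isPreirreducible_preimage_of_forall_isLocallyClosed hf hmeets
        T.isIrreducible.isPreirreducible T.isClosed⟩, T.isClosed.preimage hf.continuous⟩
  refine Order.krullDim_le_of_strictMono preimage fun T T' hlt => ?_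
  obtain ⟨hle, x, hxT', hxT⟩ := SetLike.lt_iff_le_and_exists.1 hlt
  obtain ⟨y, hyT', hyT⟩ := hmeets (T' \ T)
    (T'.isClosed.isLocallyClosed.inter T.isClosed.isOpen_compl.isLocallyClosed) ⟨x, hxT', hxT⟩
  exact SetLike.lt_iff_le_and_exists.2 ⟨preimage_mono (f := f) hle, y, hyT', hyT⟩

theorem topologicalKrullDim_le_topologicalKrullDim_preimage [JacobsonSpace X] (hf : IsInducing f)
    (hrange : closedPoints X ⊆ range f) {S : Set X} (hS : IsLocallyClosed S) :
    topologicalKrullDim S ≤ topologicalKrullDim (f ⁻¹' S) := by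
  refine topologicalKrullDim_le_of_forall_isLocallyClosed (hf.restrictPreimage S) fun T hT hne => ?_
  obtain ⟨_, ⟨x, hxT, rfl⟩, hx⟩ := nonempty_inter_closedPoints (hne.image Subtype.val)
    (hT.image IsInducing.subtypeVal (by rwa [Subtype.range_coe]))
  obtain ⟨y, hy⟩ := hrange hx
  have hyS : f y ∈ S := hy ▸ x.2
  have hyx : S.restrictPreimage f ⟨y, hyS⟩ = x := Subtype.ext hy
  exact ⟨⟨y, hyS⟩, by rwa [mem_preimage, hyx]⟩

end KrullDimension

section Constructible

open Topology TopologicalSpace Set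

variable {X Y : Type*} [TopologicalSpace X] [TopologicalSpace Y]

-- `interior (coborder s) ∩ s` is the set of points of `s` near which `s` is locally closed.
theorem compl_closure_subset_interior_coborder (s : Set X) :
    (closure s)ᶜ ⊆ interior (coborder s) :=
  interior_maximal (by simp [coborder_eq_union_closure_compl]) isClosed_closure.isOpen_compl

theorem interior_coborder_inter_subset (s t : Set X) :
    interior (coborder s) ∩ interior (coborder t) ⊆ interior (coborder (s ∪ t)) := by
  rw [← interior_inter]
  refine interior_mono fun x ⟨hs, ht⟩ => ?_
  simp only [coborder_eq_union_closure_compl, closure_union, mem_union, mem_compl_iff] at hs ht ⊢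
  tauto

theorem subset_closure_inter_interior_coborder_union {s t : Set X}
    (hs : s ⊆ closure (s ∩ interior (coborder s)))
    (ht : t ⊆ closure (t ∩ interior (coborder t))) :
    s ⊆ closure ((s ∪ t) ∩ interior (coborder (s ∪ t))) := by
  intro x hx
  refine mem_closure_iff.2 fun o ho hxo => ?_
  obtain ⟨y, hyo, hys, hy⟩ := mem_closure_iff.1 (hs hx) o ho hxo
  by_cases hyt : y ∈ closure t
  · obtain ⟨w, ⟨hwo, hws⟩, hwt⟩ := mem_closure_iff.1 hyt _ (ho.inter isOpen_interior) ⟨hyo, hy⟩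
    obtain ⟨v, ⟨hvo, hvs⟩, hvt, hv⟩ :=
      mem_closure_iff.1 (ht hwt) _ (ho.inter isOpen_interior) ⟨hwo, hws⟩
    exact ⟨v, hvo, .inr hvt, interior_coborder_inter_subset s t ⟨hvs, hv⟩⟩
  · exact ⟨y, hyo, .inl hys, interior_coborder_inter_subset s t
      ⟨hy, compl_closure_subset_interior_coborder t hyt⟩⟩

theorem subset_closure_inter_interior_coborder_of_isConstructible {s : Set X}
    (hs : IsConstructible s) : s ⊆ closure (s ∩ interior (coborder s)) := by
  induction s, hs using BooleanSubalgebra.closure_sdiff_sup_induction with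
  | isSublattice =>
    exact ⟨fun s hs t ht => ⟨hs.1.union ht.1, hs.2.union ht.2⟩,
      fun s hs t ht => ⟨hs.1.inter ht.1, hs.2.inter_isOpen ht.2 ht.1⟩⟩
  | bot_mem => exact ⟨isOpen_empty, .empty⟩
  | top_mem => exact ⟨isOpen_univ, .univ⟩
  | sdiff U hU V hV =>
    have : IsLocallyClosed (U \ V) := hU.1.isLocallyClosed.inter hV.1.isClosed_compl.isLocallyClosed
    rw [this.isOpen_coborder.interior_eq, inter_eq_left.2 subset_coborder]
    exact subset_closure
  | sup s _ t _ hs ht =>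
    refine union_subset (subset_closure_inter_interior_coborder_union hs ht) ?_
    rw [show s ⊔ t = t ∪ s from union_comm s t]
    exact subset_closure_inter_interior_coborder_union ht hs

theorem isConstructible_preimage_of_noetherianSpace [NoetherianSpace Y] {f : Y → X}
    (hf : Continuous f) {s : Set X} (hs : IsConstructible s) : IsConstructible (f ⁻¹' s) :=
  hs.preimage hf fun _ _ _ _ _ _ => NoetherianSpace.isCompact _

end Constructible

section Orbit

open Topology TopologicalSpace Set MulAction
open scoped Pointwise

variable {Γ X : Type*} [Group Γ] [TopologicalSpace X] [MulAction Γ X]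

theorem mem_orbit_of_closure_orbit_eq {x y : X} (hx : IsLocallyClosed (orbit Γ x))
    (h : closure (orbit Γ y) = closure (orbit Γ x)) : y ∈ orbit Γ x := by
  obtain ⟨_, hco, g, rfl⟩ := mem_closure_iff.1 (h.ge (subset_closure (mem_orbit_self x))) _
    hx.isOpen_coborder (subset_coborder (mem_orbit_self x))
  have hmem : g • y ∈ orbit Γ x :=
    closure_inter_coborder.le ⟨h.le (subset_closure (mem_orbit y g)), hco⟩
  exact orbit_eq_iff.2 hmem ▸ mem_orbit_smul g y

variable [ContinuousConstSMul Γ X]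

theorem smul_coborder (g : Γ) (s : Set X) : g • coborder s = coborder (g • s) := by
  simp only [coborder, smul_set_compl, smul_set_sdiff, closure_smul]

theorem isLocallyClosed_orbit_of_isConstructible {x : X} (h : IsConstructible (orbit Γ x)) :
    IsLocallyClosed (orbit Γ x) := by
  have hinv (g : Γ) : g • interior (coborder (orbit Γ x)) = interior (coborder (orbit Γ x)) := by
    rw [← interior_smul, smul_coborder, smul_orbit]
  obtain ⟨y, hy, hyint⟩ : (orbit Γ x ∩ interior (coborder (orbit Γ x))).Nonempty :=
    closure_nonempty_iff.1 ((nonempty_orbit x).mono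
      (subset_closure_inter_interior_coborder_of_isConstructible h))
  have horbit : orbit Γ x ⊆ interior (coborder (orbit Γ x)) := by
    rw [← orbit_eq_iff.2 hy]
    rintro _ ⟨g, rfl⟩
    rw [orbit_eq_iff.2 hy, ← hinv g]
    exact smul_mem_smul_set hyint
  rw [isLocallyClosed_iff_isOpen_coborder, ← subset_interior_iff_isOpen]
  conv_lhs => rw [coborder_eq_union_closure_compl]
  exact union_subset horbit (compl_closure_subset_interior_coborder _)

theorem closure_orbit_subset {x y : X} (h : y ∈ closure (orbit Γ x)) :
    closure (orbit Γ y) ⊆ closure (orbit Γ x) := by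
  refine closure_minimal ?_ isClosed_closure
  rintro _ ⟨g, rfl⟩
  exact smul_closure_orbit_subset g x (smul_mem_smul_set h)

theorem exists_isClosed_orbit_subset_closure [NoetherianSpace X]
    (h : ∀ x : X, IsLocallyClosed (orbit Γ x)) (x : X) :
    ∃ y, IsClosed (orbit Γ y) ∧ orbit Γ y ⊆ closure (orbit Γ x) := by
  obtain ⟨_, ⟨y, hy, rfl⟩, hmin⟩ := WellFounded.has_min (wellFounded_lt (α := Closeds X))
    ((fun y => Closeds.closure (orbit Γ y)) '' closure (orbit Γ x))
    ⟨_, x, subset_closure (mem_orbit_self x), rfl⟩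
  refine ⟨y, isClosed_of_closure_subset fun w hw => ?_,
    subset_closure.trans (closure_orbit_subset hy)⟩
  refine mem_orbit_of_closure_orbit_eq (h y) (eq_of_le_of_not_lt (closure_orbit_subset hw) ?_)
  exact hmin _ ⟨w, closure_orbit_subset hy hw, rfl⟩

end Orbit

section Dimension

open Algebra

theorem ringKrullDim_le_of_isIntegral (R S : Type*) [CommRing R] [CommRing S] [Algebra R S]
    [Algebra.IsIntegral R S] : ringKrullDim S ≤ ringKrullDim R :=
  Order.krullDim_le_of_strictMono (PrimeSpectrum.comap (algebraMap R S))
    fun _ _ h => Ideal.IsIntegral.comap_lt_comap h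

theorem ringKrullDim_le_of_isIntegral_of_injective (R S : Type*) [CommRing R] [CommRing S]
    [Algebra R S] [Algebra.IsIntegral R S] [FaithfulSMul R S] :
    ringKrullDim R ≤ ringKrullDim S := by
  refine iSup_le fun l => ?_
  have hbot : (⊥ : Ideal S).comap (algebraMap R S) ≤ l.head.asIdeal := by
    rw [← RingHom.ker_eq_comap_bot,
      (RingHom.injective_iff_ker_eq_bot _).1 (FaithfulSMul.algebraMap_injective R S)]
    exact bot_le
  obtain ⟨P, -, hP, hPl⟩ := Ideal.exists_ideal_over_prime_of_isIntegral l.head.asIdeal _ hbot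
  have : P.LiesOver l.head.asIdeal := ⟨hPl.symm⟩
  obtain ⟨L, hL, -⟩ := Ideal.exists_ltSeries_of_hasGoingUp l P
  rw [← hL]
  exact le_iSup (fun p : LTSeries (PrimeSpectrum S) => (p.length : WithBot ℕ∞)) L

theorem exists_ringKrullDim_eq_and_trdeg_eq (k A : Type*) [Field k] [CommRing A] [IsDomain A]
    [Algebra k A] [Algebra.FiniteType k A] :
    ∃ s : ℕ, ringKrullDim A = s ∧ Algebra.trdeg k A = s := by
  obtain ⟨s, g, hinj, hint⟩ := exists_integral_inj_algHom_of_fg k A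
  algebraize [g.toRingHom]
  have : IsScalarTower k (MvPolynomial (Fin s) k) A :=
    .of_algebraMap_eq fun x => (g.commutes x).symm
  have : Algebra.IsIntegral (MvPolynomial (Fin s) k) A := ⟨hint⟩
  have : FaithfulSMul (MvPolynomial (Fin s) k) A :=
    (faithfulSMul_iff_algebraMap_injective _ _).2 hinj
  refine ⟨s, ?_, ?_⟩
  · rw [le_antisymm (ringKrullDim_le_of_isIntegral (MvPolynomial (Fin s) k) A)
      (ringKrullDim_le_of_isIntegral_of_injective _ A),
      MvPolynomial.ringKrullDim_of_isNoetherianRing]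
    simp
  · have h := lift_trdeg_add_eq k (MvPolynomial (Fin s) k) A
    rw [trdeg_eq_zero (R := MvPolynomial (Fin s) k)] at h
    simpa [eq_comm] using h

theorem ringKrullDim_localizationAway (k : Type*) {A : Type*} [Field k] [CommRing A] [IsDomain A]
    [Algebra k A] [Algebra.FiniteType k A] {f : A} (hf : f ≠ 0) :
    ringKrullDim (Localization.Away f) = ringKrullDim A := by
  have hM : Submonoid.powers f ≤ nonZeroDivisors A :=
    powers_le_nonZeroDivisors_of_noZeroDivisors hf
  have : IsDomain (Localization.Away f) := IsLocalization.isDomain_localization hM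
  have : Algebra.IsAlgebraic A (Localization.Away f) := IsLocalization.isAlgebraic _ (.powers f)
  have : FaithfulSMul A (Localization.Away f) :=
    (faithfulSMul_iff_algebraMap_injective _ _).2 (IsLocalization.injective _ hM)
  obtain ⟨s, hs, hs'⟩ := exists_ringKrullDim_eq_and_trdeg_eq k A
  obtain ⟨t, ht, ht'⟩ := exists_ringKrullDim_eq_and_trdeg_eq k (Localization.Away f)
  have h := trdeg_add_eq k A (A := Localization.Away f)
  rw [trdeg_eq_zero (R := A), add_zero, hs', ht'] at h
  rw [hs, ht, Nat.cast_injective h]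

end Dimension

section Spectrum

open Topology TopologicalSpace PrimeSpectrum

theorem exists_specializes_of_mem_closure {X : Type*} [TopologicalSpace X] [NoetherianSpace X]
    [QuasiSober X] {S : Set X} (hS : IsLocallyClosed S) {x : X} (hx : x ∈ closure S) :
    ∃ y ∈ S, y ⤳ x := by
  obtain ⟨C, hC, -, hirr, huniv⟩ :=
    NoetherianSpace.exists_finite_set_isClosed_irreducible (isClosed_univ (X := S))
  have hcover : S = ⋃ T ∈ C, Subtype.val '' T := by
    rw [← Set.image_iUnion₂, ← Set.sUnion_eq_biUnion, ← huniv, Set.image_univ, Subtype.range_coe]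
  rw [hcover, hC.closure_biUnion] at hx
  obtain ⟨T, hT, hxT⟩ := Set.mem_iUnion₂.1 hx
  have hirrT := (hirr T hT).image Subtype.val continuous_subtype_val.continuousOn
  obtain ⟨y, hy⟩ := QuasiSober.sober hirrT.closure isClosed_closure
  have hTS : Subtype.val '' T ⊆ S := Subtype.coe_image_subset S T
  refine ⟨y, closure_inter_coborder.le ⟨closure_mono hTS hy.mem, ?_⟩, hy.specializes hxT⟩
  exact (hy.mem_open_set_iff hS.isOpen_coborder).2 <| hirrT.nonempty.mono
    fun z hz => ⟨subset_closure hz, subset_coborder (hTS hz)⟩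

theorem topologicalKrullDim_zeroLocus {R : Type*} [CommRing R] (s : Set R) :
    topologicalKrullDim (zeroLocus s) = Order.krullDim (zeroLocus s) := by
  rw [topologicalKrullDim, ← Order.krullDim_orderDual]
  exact (Order.krullDim_eq_of_orderIso (PrimeSpectrum.zeroLocusEquivIrreducibleCloseds s)).symm

theorem ringKrullDim_quotient_le_topologicalKrullDim (k : Type*) {R : Type*} [Field k] [CommRing R]
    [Algebra k R] [Algebra.FiniteType k R] {S : Set (PrimeSpectrum R)} (hS : IsLocallyClosed S)
    {x : PrimeSpectrum R} (hx : x ∈ S) :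
    ringKrullDim (R ⧸ x.asIdeal) ≤ topologicalKrullDim S := by
  obtain ⟨_, ⟨f, rfl⟩, hxf, hf⟩ := isTopologicalBasis_basic_opens.exists_subset_of_mem_open
    (subset_coborder hx) hS.isOpen_coborder
  let A := R ⧸ x.asIdeal
  let fA : A := Ideal.Quotient.mk x.asIdeal f
  have hfA : fA ≠ 0 := fun h => hxf (Ideal.Quotient.eq_zero_iff_mem.1 h)
  let φ : PrimeSpectrum (Localization.Away fA) → PrimeSpectrum R :=
    comap (Ideal.Quotient.mk x.asIdeal) ∘ comap (algebraMap A (Localization.Away fA))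
  have hφ : IsInducing φ := (comap_isInducing_of_surjective _ _ Ideal.Quotient.mk_surjective).comp
    (localization_comap_isInducing _ (.powers fA))
  have hmem (p) : φ p ∈ S := by
    have hle : x ≤ φ p := fun a ha => by
      change algebraMap A _ (Ideal.Quotient.mk x.asIdeal a) ∈ p.asIdeal
      simp [Ideal.Quotient.eq_zero_iff_mem.2 ha]
    have hunit : IsUnit (algebraMap A (Localization.Away fA) fA) :=
      IsLocalization.Away.algebraMap_isUnit fA
    have hcl : φ p ∈ closure S :=
      ((le_iff_specializes _ _).1 hle).mem_closed isClosed_closure (subset_closure hx)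
    exact closure_inter_coborder.le
      ⟨hcl, hf fun hfp => p.2.ne_top (p.1.eq_top_of_isUnit_mem hfp hunit)⟩
  rw [← ringKrullDim_localizationAway k hfA, ← topologicalKrullDim_eq_ringKrullDim]
  exact (hφ.codRestrict hmem).topologicalKrullDim_le

theorem topologicalKrullDim_closure_le (k : Type*) {R : Type*} [Field k] [CommRing R]
    [Algebra k R] [Algebra.FiniteType k R] {S : Set (PrimeSpectrum R)} (hS : IsLocallyClosed S) :
    topologicalKrullDim (closure S) ≤ topologicalKrullDim S := by
  have := Algebra.FiniteType.isNoetherianRing k R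
  rw [← zeroLocus_vanishingIdeal_eq_closure, topologicalKrullDim_zeroLocus]
  refine iSup_le fun l => ?_
  obtain ⟨y, hyS, hy⟩ := exists_specializes_of_mem_closure hS
    ((zeroLocus_vanishingIdeal_eq_closure S).le l.head.2)
  refine le_trans ?_ (ringKrullDim_quotient_le_topologicalKrullDim k hS hyS)
  rw [ringKrullDim_quotient]
  let l' : LTSeries (zeroLocus (y.asIdeal : Set R)) :=
    { length := l.length
      toFun i := ⟨(l i).1, ((le_iff_specializes _ _).2 hy).trans (l.monotone (Fin.zero_le i))⟩
      step i := l.step i }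
  exact le_iSup (fun l : LTSeries (zeroLocus (y.asIdeal : Set R)) => (l.length : WithBot ℕ∞)) l'

end Spectrum

noncomputable section

theorem aeval_pi_apply {σ ι R : Type*} [CommSemiring R] (f : σ → ι → R) (p : MvPolynomial σ R)
    (i : ι) : MvPolynomial.aeval f p i = MvPolynomial.eval (fun s => f s i) p := by
  have h : (Pi.evalAlgHom R (fun _ : ι => R) i).comp (MvPolynomial.aeval f) =
      MvPolynomial.aeval fun s => f s i := by
    ext
    simp
  exact DFunLike.congr_fun h p

section Representation

variable {k Γ V : Type*} [CommSemiring k] [Monoid Γ] [AddCommMonoid V] [Module k V]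

/-- The subrepresentation generated by a vector. -/
def orbitSpan (ρ : Representation k Γ V) (v : V) : Subrepresentation ρ where
  toSubmodule := Submodule.span k (Set.range fun g => ρ g v)
  apply_mem_toSubmodule g w hw := by
    refine (Submodule.map_span_le (ρ g) _ _).2 ?_ (Submodule.mem_map_of_mem hw)
    rintro _ ⟨h, rfl⟩
    exact Submodule.subset_span ⟨g * h, by simp only [map_mul, Module.End.mul_apply]⟩

theorem mem_orbitSpan_self (ρ : Representation k Γ V) (v : V) : v ∈ (orbitSpan ρ v).toSubmodule :=
  Submodule.subset_span ⟨1, by simp only [map_one, Module.End.one_apply]⟩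

end Representation

namespace AffineGIT

open MvPolynomial Topology TopologicalSpace

attribute [local instance] zariski

variable {m n : ℕ}

section CoordinateRing

variable {Z : Set (Fin n → ℂ)}

variable (Z) in
/-- The restriction of polynomials to regular functions on `Z`. -/
def restrict : MvPolynomial (Fin n) ℂ →ₐ[ℂ] coordinateRing Z :=
  (aeval (R := ℂ) fun i (z : Z) => z.1 i).rangeRestrict

theorem restrict_apply (p : MvPolynomial (Fin n) ℂ) (z : Z) : (restrict Z p).1 z = eval z.1 p :=
  aeval_pi_apply _ p z

theorem restrict_surjective : Function.Surjective (restrict Z) :=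
  AlgHom.rangeRestrict_surjective _

instance : Algebra.FiniteType ℂ (coordinateRing Z) :=
  .of_surjective (restrict Z) restrict_surjective

instance : IsNoetherianRing (coordinateRing Z) :=
  Algebra.FiniteType.isNoetherianRing ℂ _

instance : IsJacobsonRing (coordinateRing Z) :=
  isJacobsonRing_of_finiteType (A := ℂ)

/-- The maximal ideal of `ℂ[Z]` at a point of `Z`, namely the kernel of evaluation. -/
def toSpec (z : Z) : PrimeSpectrum (coordinateRing Z) :=
  ⟨RingHom.ker ((Pi.evalAlgHom ℂ (fun _ : Z => ℂ) z).comp (coordinateRing Z).val),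
    RingHom.ker_isPrime _⟩

theorem mem_toSpec_iff {f : coordinateRing Z} {z : Z} : f ∈ (toSpec z).asIdeal ↔ f.1 z = 0 :=
  Iff.rfl

theorem toSpec_injective : Function.Injective (toSpec (Z := Z)) := fun z w h => by
  refine Subtype.ext (funext fun i => ?_)
  have hmem : restrict Z (X i - C (w.1 i)) ∈ (toSpec w).asIdeal := by
    simp [mem_toSpec_iff, restrict_apply]
  rw [← h, mem_toSpec_iff, restrict_apply] at hmem
  simpa [sub_eq_zero] using hmem

theorem isClosed_singleton_toSpec (z : Z) : IsClosed {toSpec z} := by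
  rw [PrimeSpectrum.isClosed_singleton_iff_isMaximal]
  exact RingHom.ker_isMaximal_of_surjective _ fun c => ⟨algebraMap ℂ _ c, rfl⟩

theorem mem_vanishingIdeal_image_toSpec {f : coordinateRing Z} {T : Set Z} :
    f ∈ PrimeSpectrum.vanishingIdeal (toSpec '' T) ↔ Set.EqOn f.1 0 T := by
  simp only [PrimeSpectrum.mem_vanishingIdeal, Set.forall_mem_image, mem_toSpec_iff]
  rfl

theorem isClosed_iff_exists_eval_eq_zero {T : Set Z} :
    IsClosed T ↔ ∃ S : Set (MvPolynomial (Fin n) ℂ), T = {z | ∀ p ∈ S, eval z.1 p = 0} := by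
  have h (W : Set (Fin n → ℂ)) : @IsClosed _ (zariskiSpace n) W ↔ IsAffineVariety W := by
    rw [← @isOpen_compl_iff _ _ (zariskiSpace n)]
    exact iff_of_eq (congrArg IsAffineVariety (compl_compl W))
  rw [@isClosed_induced_iff _ _ (zariskiSpace n)]
  simp only [h]
  constructor
  · rintro ⟨_, ⟨S, rfl⟩, rfl⟩
    exact ⟨S, rfl⟩
  · rintro ⟨S, rfl⟩
    exact ⟨zeroSet S, ⟨S, rfl⟩, rfl⟩

theorem isInducing_toSpec : IsInducing (toSpec : Z → PrimeSpectrum (coordinateRing Z)) := by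
  refine ⟨TopologicalSpace.ext_isClosed fun T => ?_⟩
  rw [isClosed_iff_exists_eval_eq_zero, isClosed_induced_iff]
  simp only [PrimeSpectrum.isClosed_iff_zeroLocus]
  constructor
  · rintro ⟨S, rfl⟩
    refine ⟨_, ⟨restrict Z '' S, rfl⟩, Set.ext fun z => ?_⟩
    simp [PrimeSpectrum.mem_zeroLocus, Set.subset_def, mem_toSpec_iff, restrict_apply]
  · rintro ⟨_, ⟨S, rfl⟩, rfl⟩
    refine ⟨restrict Z ⁻¹' S, Set.ext fun z => ?_⟩
    simp only [Set.mem_preimage, PrimeSpectrum.mem_zeroLocus, Set.subset_def, SetLike.mem_coe,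
      mem_toSpec_iff, restrict_surjective.forall, restrict_apply, Set.mem_ofPred_eq]

instance : NoetherianSpace Z := isInducing_toSpec.noetherianSpace

theorem IsAffineVariety.exists_toSpec_eq (hZ : IsAffineVariety Z)
    (I : PrimeSpectrum (coordinateRing Z)) (hI : I.asIdeal.IsMaximal) : ∃ z, toSpec z = I := by
  obtain ⟨S, rfl⟩ := hZ
  have hmax : (I.asIdeal.comap (restrict (zeroSet S))).IsMaximal :=
    Ideal.comap_isMaximal_of_surjective _ restrict_surjective
  obtain ⟨x, hx⟩ := isMaximal_iff_eq_vanishingIdeal_singleton.1 hmax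
  have hmem (p) : restrict (zeroSet S) p ∈ I.asIdeal ↔ eval x p = 0 := by
    rw [← Ideal.mem_comap, hx, mem_vanishingIdeal_singleton_iff, aeval_eq_eval]
  have hxS : x ∈ zeroSet S := fun p hp => by
    have hp0 : restrict (zeroSet S) p = 0 :=
      Subtype.ext (funext fun z => (restrict_apply p z).trans (z.2 p hp))
    exact (hmem p).1 (hp0 ▸ I.asIdeal.zero_mem)
  refine ⟨⟨x, hxS⟩, PrimeSpectrum.ext (Ideal.ext fun f => ?_)⟩
  obtain ⟨p, rfl⟩ := restrict_surjective f
  rw [hmem, mem_toSpec_iff, restrict_apply]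

theorem IsAffineVariety.closedPoints_subset_range_toSpec (hZ : IsAffineVariety Z) :
    closedPoints (PrimeSpectrum (coordinateRing Z)) ⊆ Set.range (toSpec (Z := Z)) := fun I hI =>
  hZ.exists_toSpec_eq I ((PrimeSpectrum.isClosed_singleton_iff_isMaximal I).1 hI)

theorem mem_closure_iff_forall_eqOn_zero {T : Set Z} {z : Z} :
    z ∈ closure T ↔ ∀ f : coordinateRing Z, Set.EqOn f.1 0 T → f.1 z = 0 := by
  rw [isInducing_toSpec.closure_eq_preimage_closure_image,
    ← PrimeSpectrum.zeroLocus_vanishingIdeal_eq_closure]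
  simp only [Set.mem_preimage, PrimeSpectrum.mem_zeroLocus, Set.subset_def, SetLike.mem_coe,
    mem_vanishingIdeal_image_toSpec, mem_toSpec_iff]

theorem IsAffineVariety.exists_eqOn_zero_eqOn_one (hZ : IsAffineVariety Z) {C₁ C₂ : Set Z}
    (h₁ : IsClosed C₁) (h₂ : IsClosed C₂) (hdisj : Disjoint C₁ C₂) :
    ∃ f ∈ coordinateRing Z, Set.EqOn f 0 C₁ ∧ Set.EqOn f 1 C₂ := by
  let I (C : Set Z) : Ideal (coordinateRing Z) := PrimeSpectrum.vanishingIdeal (toSpec '' C)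
  have hmem {C : Set Z} (hC : IsClosed C) {z : Z} (hz : I C ≤ (toSpec z).asIdeal) : z ∈ C :=
    hC.closure_subset <| mem_closure_iff_forall_eqOn_zero.2 fun f hf =>
      hz (mem_vanishingIdeal_image_toSpec.2 hf)
  have htop : I C₁ ⊔ I C₂ = ⊤ := by
    by_contra hne
    obtain ⟨J, hJ, hle⟩ := Ideal.exists_le_maximal _ hne
    obtain ⟨z, hz⟩ := hZ.exists_toSpec_eq ⟨J, hJ.isPrime⟩ hJ
    obtain rfl : (toSpec z).asIdeal = J := congrArg PrimeSpectrum.asIdeal hz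
    exact Set.disjoint_left.1 hdisj (hmem h₁ (le_sup_left.trans hle))
      (hmem h₂ (le_sup_right.trans hle))
  obtain ⟨f, hf, g, hg, hfg⟩ := Submodule.mem_sup.1 ((Ideal.eq_top_iff_one _).1 htop)
  refine ⟨f.1, f.2, mem_vanishingIdeal_image_toSpec.1 hf, fun z hz => ?_⟩
  have hgz : g.1 z = 0 := mem_vanishingIdeal_image_toSpec.1 hg hz
  simpa [hgz] using congrFun (congrArg Subtype.val hfg) z

theorem IsAffineVariety.zariskiDim_le_of_subset_closure (hZ : IsAffineVariety Z) {C W : Set Z}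
    (hW : IsLocallyClosed W) (hC : C ⊆ closure W) : zariskiDim C ≤ zariskiDim W := by
  obtain ⟨U, hU, hUW⟩ := isInducing_toSpec.isOpen_iff.1 hW.isOpen_coborder
  let S : Set (PrimeSpectrum (coordinateRing Z)) := closure (toSpec '' W) ∩ U
  have hS : IsLocallyClosed S := isClosed_closure.isLocallyClosed.inter hU.isLocallyClosed
  have hpre : toSpec ⁻¹' S = W := by
    rw [Set.preimage_inter, ← isInducing_toSpec.closure_eq_preimage_closure_image, hUW,
      closure_inter_coborder]
  have hWS : Set.MapsTo toSpec W S := fun z hz => by rwa [← Set.mem_preimage, hpre]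
  have hCS (z : C) : toSpec z.1 ∈ closure S :=
    map_mem_closure isInducing_toSpec.continuous (hC z.2) hWS
  calc zariskiDim C ≤ topologicalKrullDim (closure S) :=
        ((isInducing_toSpec.comp .subtypeVal).codRestrict hCS).topologicalKrullDim_le
    _ ≤ topologicalKrullDim S := topologicalKrullDim_closure_le ℂ hS
    _ ≤ topologicalKrullDim (toSpec ⁻¹' S) :=
      topologicalKrullDim_le_topologicalKrullDim_preimage isInducing_toSpec
        hZ.closedPoints_subset_range_toSpec hS
    _ = zariskiDim W := by rw [hpre, zariskiDim]

end CoordinateRing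

section RegularMap

variable {X : Set (Fin m → ℂ)} {Z : Set (Fin n → ℂ)} {h : X → Z}

/-- Morphisms of varieties: the maps whose coordinates are regular functions. -/
def IsRegularMap (h : X → Z) : Prop :=
  ∀ i, (fun x => (h x).1 i) ∈ coordinateRing X

theorem IsRegularMap.comp_mem (hh : IsRegularMap h) {f : Z → ℂ} (hf : f ∈ coordinateRing Z) :
    f ∘ h ∈ coordinateRing X := by
  obtain ⟨p, hp⟩ := restrict_surjective ⟨f, hf⟩
  obtain rfl : (restrict Z p).1 = f := congrArg Subtype.val hp
  have hcomp : (restrict Z p).1 ∘ h = aeval (fun i x => (h x).1 i) p := by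
    ext x
    rw [Function.comp_apply, restrict_apply, aeval_pi_apply]
  rw [hcomp]
  exact Subalgebra.mvPolynomial_aeval_coe (coordinateRing X) (fun i => ⟨_, hh i⟩) p ▸ Subtype.prop _

/-- The homomorphism of coordinate rings `f ↦ f ∘ h` induced by a morphism `h`. -/
def IsRegularMap.pullback (hh : IsRegularMap h) : coordinateRing Z →ₐ[ℂ] coordinateRing X where
  toFun f := ⟨f.1 ∘ h, hh.comp_mem f.2⟩
  map_one' := rfl
  map_mul' _ _ := rfl
  map_zero' := rfl
  map_add' _ _ := rfl
  commutes' _ := rfl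

theorem IsRegularMap.comap_pullback_toSpec (hh : IsRegularMap h) (x : X) :
    PrimeSpectrum.comap hh.pullback.toRingHom (toSpec x) = toSpec (h x) :=
  rfl

theorem IsRegularMap.continuous (hh : IsRegularMap h) : Continuous h :=
  isInducing_toSpec.continuous_iff.2 <|
    (PrimeSpectrum.continuous_comap hh.pullback.toRingHom).comp isInducing_toSpec.continuous

theorem IsRegularMap.isConstructible_range (hh : IsRegularMap h) (hX : IsAffineVariety X) :
    IsConstructible (Set.range h) := by
  let φ := hh.pullback.toRingHom
  have hφ : φ.FiniteType := .of_comp_finiteType (f := algebraMap ℂ (coordinateRing Z)) <|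
    RingHom.finiteType_algebraMap.2 (inferInstanceAs (Algebra.FiniteType ℂ (coordinateRing X)))
  have hrange : toSpec ⁻¹' Set.range (PrimeSpectrum.comap φ) = Set.range h := by
    refine Set.Subset.antisymm (fun z ⟨P, hP⟩ => ?_) ?_
    · have hfib : IsClosed (PrimeSpectrum.comap φ ⁻¹' {toSpec z}) :=
        (isClosed_singleton_toSpec z).preimage (PrimeSpectrum.continuous_comap φ)
      obtain ⟨Q, hQz, hQ⟩ := nonempty_inter_closedPoints ⟨P, hP⟩ hfib.isLocallyClosed
      obtain ⟨x, rfl⟩ := hX.closedPoints_subset_range_toSpec hQ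
      exact ⟨x, toSpec_injective ((hh.comap_pullback_toSpec x).symm.trans hQz)⟩
    · rintro _ ⟨x, rfl⟩
      exact ⟨toSpec x, hh.comap_pullback_toSpec x⟩
  rw [← hrange]
  exact isConstructible_preimage_of_noetherianSpace isInducing_toSpec.continuous
    (PrimeSpectrum.isConstructible_range_comap (.of_finiteType.1 hφ))

end RegularMap

variable {G : Set (Fin m → ℂ)} {Z : Set (Fin n → ℂ)}

section Product

variable {f : G → Z → ℂ}

theorem IsRegularOnProd.exists_sum_mul (hf : IsRegularOnProd f) :
    ∃ (ι : Type) (_ : Fintype ι) (a : ι → coordinateRing G) (b : ι → coordinateRing Z),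
      ∀ g z, f g z = ∑ i, (a i).1 g * (b i).1 z := by
  obtain ⟨q, hq⟩ := hf
  refine ⟨q.support, inferInstance,
    fun d => restrict G (C (coeff d.1 q) * ∏ i, X i ^ d.1 (.inl i)),
    fun d => restrict Z (∏ i, X i ^ d.1 (.inr i)), fun g z => ?_⟩
  rw [hq, eval_eq', ← Finset.sum_coe_sort]
  simp [Fintype.prod_sum_type, mul_assoc, restrict_apply]

theorem IsRegularOnProd.left_mem (hf : IsRegularOnProd f) (z : Z) :
    (fun g => f g z) ∈ coordinateRing G := by
  obtain ⟨ι, _, a, b, hab⟩ := hf.exists_sum_mul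
  have : (fun g => f g z) = ∑ i, (b i).1 z • (a i).1 := by
    ext g
    simp [hab, mul_comm]
  exact this ▸ sum_mem fun i _ => Subalgebra.smul_mem _ (a i).2 _

theorem IsRegularOnProd.right_mem (hf : IsRegularOnProd f) (g : G) :
    f g ∈ coordinateRing Z := by
  obtain ⟨ι, _, a, b, hab⟩ := hf.exists_sum_mul
  have : f g = ∑ i, (a i).1 g • (b i).1 := by
    ext z
    simp [hab]
  exact this ▸ sum_mem fun i _ => Subalgebra.smul_mem _ (b i).2 _

end Product

variable [Group G] [MulAction G Z]

section Action

theorem IsAlgebraicAction.isRegularMap_smul (hact : IsAlgebraicAction G Z) (g : G) :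
    IsRegularMap fun z : Z => g • z :=
  fun i => (hact i).right_mem g

theorem IsAlgebraicAction.isRegularMap_orbit (hact : IsAlgebraicAction G Z) (z : Z) :
    IsRegularMap fun g : G => g • z :=
  fun i => (hact i).left_mem z

theorem IsAlgebraicAction.continuousConstSMul (hact : IsAlgebraicAction G Z) :
    ContinuousConstSMul G Z :=
  ⟨fun g => (hact.isRegularMap_smul g).continuous⟩

theorem IsAlgebraicAction.isLocallyClosed_orbit (hact : IsAlgebraicAction G Z)
    (hG : IsAffineVariety G) (z : Z) : IsLocallyClosed (MulAction.orbit G z) :=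
  have := hact.continuousConstSMul
  isLocallyClosed_orbit_of_isConstructible ((hact.isRegularMap_orbit z).isConstructible_range hG)

theorem IsAlgebraicAction.orbitClosure_subset (hact : IsAlgebraicAction G Z) {z w : Z}
    (hw : w ∈ orbitClosure G z) : orbitClosure G w ⊆ orbitClosure G z :=
  have := hact.continuousConstSMul
  closure_orbit_subset hw

theorem IsAlgebraicAction.exists_isClosedOrbitIn (hact : IsAlgebraicAction G Z)
    (hG : IsAffineVariety G) (z : Z) : ∃ C, IsClosedOrbitIn G z C := by
  have := hact.continuousConstSMul
  obtain ⟨w, hw, hwz⟩ := exists_isClosed_orbit_subset_closure (hact.isLocallyClosed_orbit hG) z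
  exact ⟨_, ⟨w, rfl⟩, hw, hwz⟩

theorem IsAlgebraicAction.isRegularOnProd_comp_smul (hact : IsAlgebraicAction G Z)
    (f : coordinateRing Z) : IsRegularOnProd fun (g : G) (z : Z) => f.1 (g • z) := by
  obtain ⟨p, rfl⟩ := restrict_surjective f
  choose q hq using hact
  refine ⟨bind₁ q p, fun g z => ?_⟩
  refine (restrict_apply p (g • z)).trans ?_
  rw [← aeval_eq_eval, ← aeval_eq_eval, aeval_bind₁]
  simp only [aeval_eq_eval, ← hq]

end Action

section RegularRepresentation

/-- The representation of `G` on `ℂ[Z]` by translation: `(g f)(z) = f(g⁻¹ z)`. -/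
def IsAlgebraicAction.regularRepresentation (hact : IsAlgebraicAction G Z) :
    Representation ℂ G (coordinateRing Z) where
  toFun g := (hact.isRegularMap_smul g⁻¹).pullback.toLinearMap
  map_one' := LinearMap.ext fun f => Subtype.ext <| funext fun z => by
    change f.1 ((1 : G)⁻¹ • z) = f.1 z
    rw [inv_one, one_smul]
  map_mul' g h := LinearMap.ext fun f => Subtype.ext <| funext fun z => by
    change f.1 ((g * h)⁻¹ • z) = f.1 (h⁻¹ • g⁻¹ • z)
    rw [mul_inv_rev, mul_smul]

theorem IsAlgebraicAction.regularRepresentation_apply (hact : IsAlgebraicAction G Z) (g : G)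
    (f : coordinateRing Z) (z : Z) : (hact.regularRepresentation g f).1 z = f.1 (g⁻¹ • z) :=
  rfl

theorem IsAlgebraicAction.exists_regularRepresentation_eq_sum (hact : IsAlgebraicAction G Z)
    (f : coordinateRing Z) :
    ∃ (ι : Type) (_ : Fintype ι) (a : ι → coordinateRing G) (b : ι → coordinateRing Z),
      ∀ g, hact.regularRepresentation g f = ∑ i, (a i).1 g⁻¹ • b i := by
  obtain ⟨ι, _, a, b, hab⟩ := (hact.isRegularOnProd_comp_smul f).exists_sum_mul
  refine ⟨ι, inferInstance, a, b, fun g => Subtype.ext (funext fun z => ?_)⟩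
  rw [hact.regularRepresentation_apply, hab]
  simp

theorem IsAlgebraicAction.finiteDimensional_orbitSpan (hact : IsAlgebraicAction G Z)
    (f : coordinateRing Z) :
    FiniteDimensional ℂ (orbitSpan hact.regularRepresentation f).toSubmodule := by
  obtain ⟨ι, _, a, b, hab⟩ := hact.exists_regularRepresentation_eq_sum f
  have : FiniteDimensional ℂ (Submodule.span ℂ (Set.range b)) :=
    FiniteDimensional.span_of_finite ℂ (Set.finite_range b)
  refine Submodule.finiteDimensional_of_le (S₂ := Submodule.span ℂ (Set.range b))
    (Submodule.span_le.2 ?_)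
  rintro _ ⟨g, rfl⟩
  simp only [hab]
  exact sum_mem fun i _ => Submodule.smul_mem _ _ (Submodule.subset_span ⟨i, rfl⟩)

theorem IsAlgebraicAction.isAlgebraicRep_regularRepresentation (hact : IsAlgebraicAction G Z)
    (hinv : IsRegularMap fun g : G => g⁻¹) : IsAlgebraicRep G hact.regularRepresentation := by
  intro f ξ
  obtain ⟨ι, _, a, b, hab⟩ := hact.exists_regularRepresentation_eq_sum f
  have h : (fun g => ξ (hact.regularRepresentation g f)) = ∑ i, ξ (b i) • (a i).1 ∘ (·⁻¹) := by
    ext g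
    simp [hab, mul_comm]
  exact h ▸ sum_mem fun i _ => Subalgebra.smul_mem _ (hinv.comp_mem (a i).2) _

theorem IsAlgebraicAction.coe_mem_invariantRing (hact : IsAlgebraicAction G Z)
    {f : coordinateRing Z} (hf : f ∈ hact.regularRepresentation.invariants) :
    f.1 ∈ invariantRing G Z := by
  refine ⟨f.2, fun g z => ?_⟩
  rw [← congrArg (fun h => h.1 z) (hf g⁻¹), hact.regularRepresentation_apply, inv_inv]

theorem IsAlgebraicRep.toRepresentation {M : Type} [AddCommGroup M] [Module ℂ M]
    {ρ : Representation ℂ G M} (hρ : IsAlgebraicRep G ρ) (V : Subrepresentation ρ) :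
    IsAlgebraicRep G V.toRepresentation := by
  intro v ξ
  obtain ⟨ξ', rfl⟩ := LinearMap.exists_extend ξ
  exact hρ v ξ'

end RegularRepresentation

section Nagata

theorem NagataHypothesis.exists_mem_invariants_ne_zero (hN : NagataHypothesis G) (M : Type)
    [AddCommGroup M] [Module ℂ M] [FiniteDimensional ℂ M] {ρ : Representation ℂ G M}
    (hρ : IsAlgebraicRep G ρ) {l : Module.Dual ℂ M} (hl : l ≠ 0)
    (hinv : ∀ g x, l (ρ g x) = l x) : ∃ v ∈ ρ.invariants, l v ≠ 0 := by
  induction hd : Module.finrank ℂ M using Nat.strong_induction_on generalizing M with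
  | _ d ih =>
  obtain ⟨H, P, hHP, hH, hHinv, hP⟩ := hN M ρ hρ (LinearMap.ker l)
    (by rw [(l.quotKerEquivOfSurjective (LinearMap.surjective hl)).finrank_eq,
      Module.finrank_self])
    (fun g x hx => by rwa [LinearMap.mem_ker, hinv])
    (fun g x => by rw [LinearMap.mem_ker, map_sub, hinv, sub_self])
  by_cases hPl : P ≤ LinearMap.ker l
  · let V : Subrepresentation ρ := ⟨H, fun g x hx => hHinv g x hx⟩
    have hlH : l.domRestrict H ≠ 0 := fun h => hl <| LinearMap.ker_eq_top.1 <|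
      top_le_iff.1 <| hHP.sup_eq_top ▸ sup_le (fun x hx => LinearMap.congr_fun h ⟨x, hx⟩) hPl
    have hlt : Module.finrank ℂ H < d := by
      have := H.finrank_quotient_add_finrank
      omega
    obtain ⟨v, hv, hlv⟩ :=
      ih _ hlt H (hρ.toRepresentation V) hlH (fun g x => hinv g x) rfl
    exact ⟨v, fun g => congrArg Subtype.val (hv g), hlv⟩
  · obtain ⟨x, hx, hlx⟩ := SetLike.not_le_iff_exists.1 hPl
    exact ⟨x, fun g => hP g x hx, hlx⟩

end Nagata

section Quotient

theorem IsAlgebraicAction.exists_mem_invariantRing_eqOn_zero (hact : IsAlgebraicAction G Z)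
    (hinv : IsRegularMap fun g : G => g⁻¹) (hN : NagataHypothesis G) (hZ : IsAffineVariety Z)
    {C₁ C₂ : Set Z} (h₁ : IsClosed C₁) (h₂ : IsClosed C₂) (hdisj : Disjoint C₁ C₂)
    (hG₁ : ∀ g : G, Set.MapsTo (g • ·) C₁ C₁) (hG₂ : ∀ g : G, Set.MapsTo (g • ·) C₂ C₂)
    {z₂ : Z} (hz₂ : z₂ ∈ C₂) : ∃ f ∈ invariantRing G Z, Set.EqOn f 0 C₁ ∧ f z₂ ≠ 0 := by
  obtain ⟨f₀, hf₀, hf₀C₁, hf₀C₂⟩ := hZ.exists_eqOn_zero_eqOn_one h₁ h₂ hdisj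
  let f : coordinateRing Z := ⟨f₀, hf₀⟩
  let ρ := hact.regularRepresentation
  let V := orbitSpan ρ f
  have := hact.finiteDimensional_orbitSpan f
  let ev (z : Z) : Module.Dual ℂ (coordinateRing Z) :=
    ((Pi.evalAlgHom ℂ (fun _ : Z => ℂ) z).comp (coordinateRing Z).val).toLinearMap
  have hV₁ {z : Z} (hz : z ∈ C₁) : V.toSubmodule ≤ LinearMap.ker (ev z) := by
    refine Submodule.span_le.2 ?_
    rintro _ ⟨g, rfl⟩
    exact hf₀C₁ (hG₁ g⁻¹ hz)
  have hV₂ {z : Z} (hz : z ∈ C₂) : Set.EqOn (ev z) (ev z₂) V.toSubmodule := by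
    refine LinearMap.eqOn_span ?_
    rintro _ ⟨g, rfl⟩
    exact (hf₀C₂ (hG₂ g⁻¹ hz)).trans (hf₀C₂ (hG₂ g⁻¹ hz₂)).symm
  have hne : (ev z₂).domRestrict V.toSubmodule ≠ 0 := fun h =>
    one_ne_zero ((hf₀C₂ hz₂).symm.trans (LinearMap.congr_fun h ⟨f, mem_orbitSpan_self ρ f⟩))
  obtain ⟨v, hv, hvz₂⟩ := hN.exists_mem_invariants_ne_zero V.toSubmodule
    ((hact.isAlgebraicRep_regularRepresentation hinv).toRepresentation V) hne
    fun g x => hV₂ (hG₂ g⁻¹ hz₂) x.2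
  exact ⟨v.1.1, hact.coe_mem_invariantRing fun g => congrArg Subtype.val (hv g),
    fun z hz => hV₁ hz v.2, hvz₂⟩

theorem eq_of_mem_orbitClosure {f : Z → ℂ} (hf : f ∈ invariantRing G Z) {z w : Z}
    (hw : w ∈ orbitClosure G z) : f w = f z := by
  let f' : coordinateRing Z := ⟨f, hf.1⟩ - algebraMap ℂ _ (f z)
  refine sub_eq_zero.1 (mem_closure_iff_forall_eqOn_zero.1 hw f' ?_)
  rintro _ ⟨g, rfl⟩
  exact sub_eq_zero.2 (hf.2 g z)

theorem IsAlgebraicAction.closuresMeet_iff (hact : IsAlgebraicAction G Z)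
    (hinv : IsRegularMap fun g : G => g⁻¹) (hN : NagataHypothesis G) (hZ : IsAffineVariety Z)
    (z₁ z₂ : Z) : ClosuresMeet G z₁ z₂ ↔ ∀ f ∈ invariantRing G Z, f z₁ = f z₂ := by
  constructor
  · rintro ⟨w, hw₁, hw₂⟩ f hf
    rw [← eq_of_mem_orbitClosure hf hw₁, eq_of_mem_orbitClosure hf hw₂]
  · intro h
    by_contra hmeet
    have := hact.continuousConstSMul
    have hmem (z : Z) : z ∈ orbitClosure G z := subset_closure (MulAction.mem_orbit_self z)
    have hstable (z : Z) (g : G) : Set.MapsTo (g • ·) (orbitClosure G z) (orbitClosure G z) :=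
      fun w hw => smul_closure_orbit_subset g z ⟨w, hw, rfl⟩
    obtain ⟨f, hf, hf₁, hf₂⟩ := hact.exists_mem_invariantRing_eqOn_zero hinv hN hZ
      isClosed_closure isClosed_closure
      (Set.disjoint_iff_inter_eq_empty.2 (Set.not_nonempty_iff_eq_empty.1 hmeet))
      (hstable z₁) (hstable z₂) (hmem z₂)
    exact hf₂ ((h f hf).symm.trans (hf₁ (hmem z₁)))

theorem IsAlgebraicAction.equivalence_closuresMeet (hact : IsAlgebraicAction G Z)
    (hinv : IsRegularMap fun g : G => g⁻¹) (hN : NagataHypothesis G) (hZ : IsAffineVariety Z) :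
    Equivalence fun z₁ z₂ : Z => ClosuresMeet G z₁ z₂ := by
  simp only [hact.closuresMeet_iff hinv hN hZ]
  exact ⟨fun _ _ _ => rfl, fun h f hf => (h f hf).symm, fun h h' f hf => (h f hf).trans (h' f hf)⟩

theorem IsAlgebraicAction.isClosedOrbitIn_unique (hact : IsAlgebraicAction G Z)
    (hinv : IsRegularMap fun g : G => g⁻¹) (hN : NagataHypothesis G) (hZ : IsAffineVariety Z)
    {z : Z} {C C' : Set Z} (hC : IsClosedOrbitIn G z C) (hC' : IsClosedOrbitIn G z C') :
    C = C' := by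
  obtain ⟨⟨w, rfl⟩, hcl, hsub⟩ := hC
  obtain ⟨⟨w', rfl⟩, hcl', hsub'⟩ := hC'
  obtain ⟨y, hy, hy'⟩ := (hact.closuresMeet_iff hinv hN hZ w w').2 fun f hf => by
    rw [eq_of_mem_orbitClosure hf (hsub (MulAction.mem_orbit_self w)),
      eq_of_mem_orbitClosure hf (hsub' (MulAction.mem_orbit_self w'))]
  rw [← MulAction.orbit_eq_iff.2 (hcl.closure_subset hy),
    MulAction.orbit_eq_iff.2 (hcl'.closure_subset hy')]

theorem IsAlgebraicAction.zariskiDim_le_of_isClosedOrbitIn (hact : IsAlgebraicAction G Z)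
    (hG : IsAffineVariety G) (hinv : IsRegularMap fun g : G => g⁻¹) (hN : NagataHypothesis G)
    (hZ : IsAffineVariety Z) {z w : Z} {C : Set Z} (hC : IsClosedOrbitIn G z C)
    (hw : w ∈ orbitClosure G z) : zariskiDim C ≤ zariskiDim (MulAction.orbit G w) := by
  obtain ⟨C', horb, hcl, hsub⟩ := hact.exists_isClosedOrbitIn hG w
  obtain rfl : C = C' := hact.isClosedOrbitIn_unique hinv hN hZ hC
    ⟨horb, hcl, hsub.trans (hact.orbitClosure_subset hw)⟩
  exact hZ.zariskiDim_le_of_subset_closure (hact.isLocallyClosed_orbit hG w) hsub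

end Quotient

end AffineGIT

end

theorem mainTheorem10_general {m n : ℕ}
    (G : Set (Fin m → ℂ)) [Group G] (hG : AffineGIT.IsAffineVariety G)
    (hinv : AffineGIT.IsRegularMap fun g : G => g⁻¹) (hN : AffineGIT.NagataHypothesis G)
    (Z : Set (Fin n → ℂ)) (hZ : AffineGIT.IsAffineVariety Z)
    [MulAction G Z] (hact : AffineGIT.IsAlgebraicAction G Z) :
    Equivalence (fun z₁ z₂ : Z => AffineGIT.ClosuresMeet G z₁ z₂) ∧
    (∀ z₁ z₂ : Z, AffineGIT.ClosuresMeet G z₁ z₂ ↔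
      ∀ f ∈ AffineGIT.invariantRing G Z, f z₁ = f z₂) ∧
    (∀ z : Z, ∃ C : Set Z,
      AffineGIT.IsClosedOrbitIn G z C ∧
      (∀ C' : Set Z, AffineGIT.IsClosedOrbitIn G z C' → C' = C) ∧
      (∀ w : Z, MulAction.orbit G w ⊆ AffineGIT.orbitClosure G z →
        AffineGIT.zariskiDim C ≤ AffineGIT.zariskiDim (MulAction.orbit G w))) := by
  refine ⟨hact.equivalence_closuresMeet hinv hN hZ, hact.closuresMeet_iff hinv hN hZ, fun z => ?_⟩
  obtain ⟨C, hC⟩ := hact.exists_isClosedOrbitIn hG z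
  exact ⟨C, hC, fun C' hC' => hact.isClosedOrbitIn_unique hinv hN hZ hC' hC, fun w hw =>
    hact.zariskiDim_le_of_isClosedOrbitIn hG hinv hN hZ hC (hw (MulAction.mem_orbit_self w))⟩

theorem mainTheorem10 {m n : ℕ}
    (G : Set (Fin m → ℂ)) [Group G] (hG : AffineGIT.IsAlgebraicGroup G)
    (hN : AffineGIT.NagataHypothesis G)
    (Z : Set (Fin n → ℂ)) (hZ : AffineGIT.IsAffineVariety Z)
    [MulAction G Z] (hact : AffineGIT.IsAlgebraicAction G Z) :
    Equivalence (fun z₁ z₂ : Z => AffineGIT.ClosuresMeet G z₁ z₂) ∧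
    (∀ z₁ z₂ : Z, AffineGIT.ClosuresMeet G z₁ z₂ ↔
      ∀ f ∈ AffineGIT.invariantRing G Z, f z₁ = f z₂) ∧
    (∀ z : Z, ∃ C : Set Z,
      AffineGIT.IsClosedOrbitIn G z C ∧
      (∀ C' : Set Z, AffineGIT.IsClosedOrbitIn G z C' → C' = C) ∧
      (∀ w : Z, MulAction.orbit G w ⊆ AffineGIT.orbitClosure G z →
        AffineGIT.zariskiDim C ≤ AffineGIT.zariskiDim (MulAction.orbit G w))) :=
  mainTheorem10_general G hG.isAffineVariety hG.regular_inv hN Z hZ hact
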